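/- Let $p>5$ be a prime. For a rational number $x$ and an integer $n\ge 0$ write $(x)_n=x(x+1)\cdots(x+n-1)$ (so $(x)_0=1$), and for integers $\ell,m\ge1$ write $H_m^{(\ell)}=\sum_{k=1}^{m}1/k^{\ell}$. Let $\Gamma_p:\mathbb{Z}_p\to\mathbb{Z}_p$ be Morita's $p$-adic Gamma function: $\Gamma_p(0)=1$, $\Gamma_p(n)=(-1)^n\prod_{1\le k<n,\ p\nmid k}k$ for integers $n\ge 1$, and $\Gamma_p(x)=\lim_{n\in\mathbb{N},\ |x-n|_p\to0}\Gamma_p(n)$ for $x\in\mathbb{Z}_p$. For $a,b\in\mathbb{Q}_p$, $a\equiv b\pmod{p^e}$ means $a-b\in p^e\mathbb{Z}_p$. If $p\equiv 1\pmod 4$, then $$\frac{(1/2)_{(p-1)/4}^2}{\big((p-1)/4\big)!^2}\Big\{1+\frac{p^2}{4}H^{(2)}_{(p-1)/2}-\frac{p^2}{8}H^{(2)}_{(p-1)/4}\Big\}\equiv-\Gamma_p(1/4)^4\pmod{p^4}.$$ If $p\equiv 3\pmod 4$, then $$\frac{(3/4)_{(p-1)/2}}{(5/4)_{(p-1)/2}}\equiv-\frac{p}{16}\,\Gamma_p(1/4)^4\pmod{p^3}.$$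 -/

import Mathlib

/-- Morita's `p`-adic Gamma function at a natural number:
`Γ_p(0) = 1` and `Γ_p(n) = (-1)^n ∏_{1 ≤ k < n, p ∤ k} k` for `n ≥ 1`. -/
def padicGammaNat (p n : ℕ) : ℤ :=
  (-1) ^ n * ∏ k ∈ (Finset.Ico 1 n).filter (fun k => ¬ p ∣ k), (k : ℤ)

/-- Morita's `p`-adic Gamma function on `ℤ_[p]`: the limit of `Γ_p(n)` as the natural number `n`
tends `p`-adically to `x`. The filter is proper because `ℕ` is dense in `ℤ_[p]`,
and the limit exists for every odd prime `p`. -/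
noncomputable def padicGamma (p : ℕ) [Fact p.Prime] (x : ℤ_[p]) : ℤ_[p] :=
  Filter.limUnder (Filter.comap (fun n : ℕ => (n : ℤ_[p])) (nhds x))
    (fun n : ℕ => (padicGammaNat p n : ℤ_[p]))

/-- The shifted factorial `(x)_n = x (x + 1) ⋯ (x + n - 1)` of a rational number. -/
noncomputable def shiftedFactorial (x : ℚ) (n : ℕ) : ℚ := (ascPochhammer ℚ n).eval x

/-- The harmonic number of order `l`: `H_m^{(l)} = ∑_{k=1}^m 1 / k^l`. -/
def harmonicOrder (l m : ℕ) : ℚ := ∑ k ∈ Finset.Icc 1 m, 1 / (k : ℚ) ^ l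

/-- Congruence modulo `p ^ e` of `p`-adic numbers: the difference lies in `p ^ e ℤ_[p]`. -/
def PadicCongr (p : ℕ) [Fact p.Prime] (e : ℕ) (x y : ℚ_[p]) : Prop :=
  ∃ z : ℤ_[p], x - y = (p : ℚ_[p]) ^ e * (z : ℚ_[p])

/-!
Let `2 w + p = 2 x`, so that `w, w + 1, …, w + p - 1` is a window centred at `x - 1/2`, and let `S`
be the sum of `1 / (w + j)` over the units of this window. Shifting one argument of `Γ_p(w + y)
Γ_p(w - y + p)`, where `p ∣ y`, forward by `p` and the other one back multiplies it by the quotient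
of `∏ (1 + y / (w + j))` and `∏ (1 - y / (w + j))`. The logarithm of this quotient is odd in `y`,
and the power sums of the `1 / (w + j)` of exponents `1` and `3` are divisible by `p` if `p > 3`, so
that the quotient is `1 + 2 y S` modulo `p^4`. Induction on `h ∈ ℕ` and continuity in `h ∈ ℤ_p` give
`Γ_p(x + p h) Γ_p(x - p h) ≡ Γ_p(x)^2 (1 + p h^2 S)` modulo `p^4`.

The functional equation and the reflection formula express the shifted factorials through such
products with `x = 1/4`, where `h = 1/4` if `p ≡ 1 [MOD 4]` and `h = 1/2` if `p ≡ 3 [MOD 4]`. In the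
second case they contribute a factor `p`, and the congruence modulo `p^2` is enough. In the first
case `S` is evaluated modulo `p^3` by comparing harmonic sums with their reflections `i ↦ p - i` and
with their even and odd parts.
-/

open Finset Ring

/-- The factor `c(x)` in the functional equation `Γ_p(x + 1) = c(x) Γ_p(x)`. -/
noncomputable def gammaStep {R : Type*} [Ring R] (x : R) : R :=
  open Classical in if IsUnit x then -x else -1

theorem gammaStep_of_isUnit {R : Type*} [Ring R] {x : R} (hx : IsUnit x) : gammaStep x = -x :=
  if_pos hx

theorem gammaStep_of_not_isUnit {R : Type*} [Ring R] {x : R} (hx : ¬ IsUnit x) :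
    gammaStep x = -1 :=
  if_neg hx

theorem gammaStep_neg_sq {R : Type*} [Ring R] (x : R) : gammaStep (-x) ^ 2 = gammaStep x ^ 2 := by
  by_cases hx : IsUnit x
  · simp [gammaStep_of_isUnit hx, gammaStep_of_isUnit hx.neg]
  · simp [gammaStep_of_not_isUnit hx, gammaStep_of_not_isUnit (mt (IsUnit.neg_iff x).1 hx)]

theorem ringInverse_neg {R : Type*} [Ring R] (x : R) : (-x)⁻¹ʳ = -x⁻¹ʳ := by
  rw [← neg_one_mul x, inverse_mul (.inl isUnit_one.neg), ← Units.val_one, ← Units.val_neg,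
    inverse_unit, inv_neg_one, Units.val_neg, Units.val_one, mul_neg_one]

section LocalRing

variable {R : Type*} [CommRing R] [IsLocalRing R]

theorem eq_or_eq_neg_of_sq_eq_sq_of_isUnit {a b : R} (h2 : IsUnit (2 : R)) (hb : IsUnit b)
    (h : a ^ 2 = b ^ 2) : a = b ∨ a = -b := by
  have hmul : (b + a) * (b - a) = 0 := by linear_combination -h
  have hsum : IsUnit ((b + a) + (b - a)) := by
    rw [show (b + a) + (b - a) = 2 * b by ring]
    exact h2.mul hb
  rcases IsLocalRing.isUnit_or_isUnit_of_isUnit_add hsum with hu | hu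
  · exact .inl (sub_eq_zero.1 (hu.mul_right_eq_zero.1 hmul)).symm
  · exact .inr (eq_neg_of_add_eq_zero_right (hu.mul_left_eq_zero.1 hmul))

theorem prod_units_eq_neg_one [Fintype Rˣ] (h2 : IsUnit (2 : R)) : ∏ u : Rˣ, u = -1 := by
  classical
  rw [← mul_prod_erase univ _ (mem_univ (-1 : Rˣ)), prod_involution (fun u _ => u⁻¹), mul_one]
  · simp
  · intro u hu hu1 hinv
    have hsq : (u : R) ^ 2 = 1 ^ 2 := by
      rw [one_pow, sq, ← Units.val_mul, ← Units.val_one, ← inv_eq_iff_mul_eq_one.1 hinv]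
    rcases eq_or_eq_neg_of_sq_eq_sq_of_isUnit h2 isUnit_one hsq with h | h
    · exact hu1 (Units.ext h)
    · exact ne_of_mem_erase hu (Units.ext (by simpa using h))
  · intro u hu
    exact mem_erase.2 ⟨fun h => ne_of_mem_erase hu (by simpa using congrArg (·⁻¹) h), mem_univ _⟩
  · simp

theorem prod_gammaStep [Fintype R] (h2 : IsUnit (2 : R)) :
    ∏ a : R, gammaStep a = (-1) ^ (Fintype.card R + 1) := by
  classical
  have hfactor (a : R) : gammaStep a = -1 * if IsUnit a then a else 1 := by
    unfold gammaStep
    split_ifs <;> simp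
  have hunits : ∏ a : R, (if IsUnit a then a else 1) = ∏ u : Rˣ, (u : R) := by
    rw [← prod_filter]
    refine (prod_nbij (Units.val : Rˣ → R) ?_ Units.val_injective.injOn ?_ fun _ _ => rfl).symm
    · simp
    · intro a ha
      obtain ⟨u, rfl⟩ := (mem_filter.1 ha).2
      exact ⟨u, by simp⟩
  simp only [hfactor]
  rw [prod_mul_distrib, prod_const, card_univ, hunits, pow_succ, ← Units.coe_prod,
    prod_units_eq_neg_one h2, Units.val_neg, Units.val_one]

theorem isUnit_add_iff_of_not_isUnit {w : R} (hw : ¬ IsUnit w) (x : R) :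
    IsUnit (x + w) ↔ IsUnit x := by
  simp only [← IsLocalRing.notMem_maximalIdeal]
  exact not_congr (Ideal.add_mem_iff_left _ ((IsLocalRing.mem_maximalIdeal w).2 hw))

theorem gammaStep_add {w : R} (hw : ¬ IsUnit w) (x : R) :
    gammaStep (x + w) = gammaStep x * (1 + w * x⁻¹ʳ) := by
  have hiff := isUnit_add_iff_of_not_isUnit hw x
  by_cases hx : IsUnit x
  · rw [gammaStep_of_isUnit hx, gammaStep_of_isUnit (hiff.2 hx)]
    linear_combination w * mul_inverse_cancel x hx
  · rw [gammaStep_of_not_isUnit hx, gammaStep_of_not_isUnit (mt hiff.1 hx), inverse_non_unit x hx]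
    ring

theorem inverse_add_of_not_isUnit {w : R} (hw : ¬ IsUnit w) (x : R) :
    (x + w)⁻¹ʳ = x⁻¹ʳ - w * x⁻¹ʳ * (x + w)⁻¹ʳ := by
  linear_combination inverse_sub_inverse (isUnit_add_iff_of_not_isUnit hw x)

theorem cube_dvd_inverse_add_sub {w : R} (hw : ¬ IsUnit w) (x : R) :
    w ^ 3 ∣ (x + w)⁻¹ʳ - (x⁻¹ʳ - w * x⁻¹ʳ ^ 2 + w ^ 2 * x⁻¹ʳ ^ 3) := by
  refine ⟨-x⁻¹ʳ ^ 3 * (x + w)⁻¹ʳ, ?_⟩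
  linear_combination (1 - w * x⁻¹ʳ + w ^ 2 * x⁻¹ʳ ^ 2) * inverse_add_of_not_isUnit hw x

theorem sq_dvd_inverse_add_sq_sub {w : R} (hw : ¬ IsUnit w) (x : R) :
    w ^ 2 ∣ (x + w)⁻¹ʳ ^ 2 - (x⁻¹ʳ ^ 2 - 2 * w * x⁻¹ʳ ^ 3) := by
  refine ⟨x⁻¹ʳ ^ 3 * (2 * (x + w)⁻¹ʳ) + x⁻¹ʳ ^ 2 * (x + w)⁻¹ʳ ^ 2, ?_⟩
  linear_combination ((x + w)⁻¹ʳ + x⁻¹ʳ - w * x⁻¹ʳ * (x + w)⁻¹ʳ - 2 * w * x⁻¹ʳ ^ 2) *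
    inverse_add_of_not_isUnit hw x

theorem dvd_inverse_add_pow_sub {w : R} (hw : ¬ IsUnit w) (x : R) (k : ℕ) :
    w ∣ (x + w)⁻¹ʳ ^ k - x⁻¹ʳ ^ k :=
  dvd_trans ⟨-(x⁻¹ʳ * (x + w)⁻¹ʳ), by linear_combination inverse_add_of_not_isUnit hw x⟩
    (sub_dvd_pow_sub_pow _ _ k)

end LocalRing

theorem exists_prod_one_add_mul_eq {R ι : Type*} [CommRing R] (s : Finset ι) (u : ι → R) :
    ∃ e₂ e₃ : R,
      2 * e₂ = (∑ i ∈ s, u i) ^ 2 - ∑ i ∈ s, u i ^ 2 ∧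
      6 * e₃ = (∑ i ∈ s, u i) ^ 3 - 3 * (∑ i ∈ s, u i) * (∑ i ∈ s, u i ^ 2)
        + 2 * ∑ i ∈ s, u i ^ 3 ∧
      ∀ y : R, y ^ 4 ∣ ∏ i ∈ s, (1 + y * u i) -
        (1 + y * (∑ i ∈ s, u i) + y ^ 2 * e₂ + y ^ 3 * e₃) := by
  classical
  induction s using Finset.induction_on with
  | empty => exact ⟨0, 0, by simp, by simp, by simp⟩
  | insert a s ha ih =>
    obtain ⟨e₂, e₃, h₂, h₃, h⟩ := ih
    simp only [sum_insert ha, prod_insert ha]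
    refine ⟨e₂ + u a * ∑ i ∈ s, u i, e₃ + u a * e₂, ?_, ?_, fun y => ?_⟩
    · linear_combination h₂
    · linear_combination h₃ + 3 * u a * h₂
    · obtain ⟨r, hr⟩ := h y
      exact ⟨(1 + y * u a) * r + u a * e₃, by linear_combination (1 + y * u a) * hr⟩

theorem sq_dvd_prod_one_add_mul_sub {R ι : Type*} [CommRing R] (s : Finset ι) (u : ι → R) (y : R) :
    y ^ 2 ∣ ∏ i ∈ s, (1 + y * u i) - (∏ i ∈ s, (1 + -y * u i)) * (1 + 2 * y * ∑ i ∈ s, u i) := by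
  obtain ⟨e₂, e₃, -, -, hexp⟩ := exists_prod_one_add_mul_eq s u
  obtain ⟨r, hr⟩ := hexp y
  obtain ⟨r', hr'⟩ := hexp (-y)
  refine ⟨e₂ + y * e₃ + y ^ 2 * r + 2 * (∑ i ∈ s, u i) ^ 2 -
    (e₂ - y * e₃ + y ^ 2 * r') * (1 + 2 * y * ∑ i ∈ s, u i), ?_⟩
  linear_combination hr - (1 + 2 * y * ∑ i ∈ s, u i) * hr'

theorem pow_four_dvd_prod_one_add_mul_sub {R ι : Type*} [CommRing R] (h6 : IsUnit (6 : R))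
    (s : Finset ι) (u : ι → R) {π y : R} (hy : π ∣ y) (h₁ : π ∣ ∑ i ∈ s, u i)
    (h₃ : π ∣ ∑ i ∈ s, u i ^ 3) :
    π ^ 4 ∣ ∏ i ∈ s, (1 + y * u i) - (∏ i ∈ s, (1 + -y * u i)) * (1 + 2 * y * ∑ i ∈ s, u i) := by
  obtain ⟨e₂, e₃, -, he₃, hexp⟩ := exists_prod_one_add_mul_eq s u
  have hdvd : π ∣ e₃ := by
    rw [← h6.dvd_mul_left, he₃]
    exact ((h₁.trans (dvd_pow_self _ three_ne_zero)).sub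
      ((h₁.mul_left 3).mul_right _)).add (h₃.mul_left 2)
  obtain ⟨r, hr⟩ := hexp y
  obtain ⟨r', hr'⟩ := hexp (-y)
  obtain ⟨t, rfl⟩ := hy
  obtain ⟨a, ha⟩ := h₁
  obtain ⟨b, rfl⟩ := hdvd
  rw [ha] at hr hr' ⊢
  refine ⟨2 * t ^ 2 * a ^ 2 + 2 * t ^ 3 * b - 2 * t ^ 3 * a * e₂ + 2 * π ^ 2 * t ^ 4 * a * b +
    t ^ 4 * r - t ^ 4 * r' * (1 + 2 * (π * t) * (π * a)), ?_⟩
  linear_combination hr - (1 + 2 * (π * t) * (π * a)) * hr'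

@[to_additive]
theorem prod_range_zmod_natCast {M : Type*} [CommMonoid M] (N : ℕ) [NeZero N] (f : ZMod N → M) :
    ∏ i ∈ range N, f i = ∏ a, f a :=
  prod_nbij' (fun i => (i : ZMod N)) ZMod.val (by simp) (fun a _ => mem_range.2 a.val_lt)
    (fun _ hi => ZMod.val_cast_of_lt (mem_range.1 hi)) (by simp) (by simp)

@[to_additive]
theorem prod_range_add_zmod_natCast {M : Type*} [CommMonoid M] (N : ℕ) [NeZero N] (c : ZMod N)
    (f : ZMod N → M) : ∏ i ∈ range N, f (c + i) = ∏ a, f a := by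
  rw [prod_range_zmod_natCast N fun a => f (c + a), ← Equiv.prod_comp (Equiv.addLeft c) f]
  rfl

section NaturalNumbers

variable {R : Type*} [CommRing R] {p : ℕ}

theorem padicGammaNat_zero : padicGammaNat p 0 = 1 := by simp [padicGammaNat]

theorem padicGammaNat_succ (n : ℕ) :
    padicGammaNat p (n + 1) = (if p ∣ n then -1 else -(n : ℤ)) * padicGammaNat p n := by
  unfold padicGammaNat
  rcases n.eq_zero_or_pos with rfl | hn
  · simp
  · rw [prod_filter, prod_filter, prod_Ico_succ_top hn]
    split_ifs <;> ring

theorem intCast_padicGammaNat_succ (hR : ∀ n : ℕ, IsUnit (n : R) ↔ ¬ p ∣ n) (n : ℕ) :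
    (padicGammaNat p (n + 1) : R) = gammaStep (n : R) * padicGammaNat p n := by
  rw [padicGammaNat_succ, gammaStep, Int.cast_mul]
  by_cases h : p ∣ n <;> simp [h, hR]

theorem intCast_padicGammaNat_add (hR : ∀ n : ℕ, IsUnit (n : R) ↔ ¬ p ∣ n) (n m : ℕ) :
    (padicGammaNat p (n + m) : R) =
      (∏ i ∈ range m, gammaStep ((n : R) + i)) * padicGammaNat p n := by
  induction m with
  | zero => simp
  | succ m ih =>
    rw [← add_assoc, intCast_padicGammaNat_succ hR, ih, prod_range_succ, Nat.cast_add]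
    ring

end NaturalNumbers

section PrimePowerModulus

variable {p : ℕ} [hp : Fact p.Prime] {k : ℕ}

theorem isUnit_natCast_zmod_prime_pow_iff (hk : k ≠ 0) (n : ℕ) :
    IsUnit (n : ZMod (p ^ k)) ↔ ¬ p ∣ n := by
  rw [ZMod.isUnit_iff_coprime, Nat.coprime_pow_right_iff (Nat.pos_of_ne_zero hk),
    Nat.coprime_comm, hp.out.coprime_iff_not_dvd]

theorem isLocalRing_zmod_prime_pow (hk : k ≠ 0) : IsLocalRing (ZMod (p ^ k)) :=
  have : Fact (1 < p ^ k) := ⟨Nat.one_lt_pow hk hp.out.one_lt⟩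
  .of_surjective' (PadicInt.toZModPow k) (ZMod.ringHom_surjective _)

theorem not_prime_dvd_two (hp2 : p ≠ 2) : ¬ p ∣ 2 :=
  mt (Nat.prime_dvd_prime_iff_eq hp.out Nat.prime_two).1 hp2

theorem not_prime_dvd_four (hp2 : p ≠ 2) : ¬ p ∣ 4 := fun h =>
  not_prime_dvd_two hp2 (hp.out.dvd_of_dvd_pow (n := 2) h)

theorem padicGammaNat_periodic (hp2 : p ≠ 2) (hk : k ≠ 0) :
    Function.Periodic (fun n => (padicGammaNat p n : ZMod (p ^ k))) (p ^ k) := by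
  have := isLocalRing_zmod_prime_pow (p := p) hk
  have hunit := isUnit_natCast_zmod_prime_pow_iff (p := p) hk
  intro n
  dsimp only
  have heven : Even (p ^ k + 1) := (hp.out.odd_of_ne_two hp2).pow.add_one
  rw [intCast_padicGammaNat_add hunit, prod_range_add_zmod_natCast _ _ gammaStep,
    prod_gammaStep (by exact_mod_cast (hunit 2).2 (not_prime_dvd_two hp2)), ZMod.card,
    heven.neg_one_pow, one_mul]

theorem pow_dvd_padicGammaNat_sub (hp2 : p ≠ 2) (hk : k ≠ 0) {m n : ℕ}
    (h : (p : ℤ_[p]) ^ k ∣ m - n) :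
    (p : ℤ_[p]) ^ k ∣ (padicGammaNat p m : ℤ_[p]) - padicGammaNat p n := by
  have hmod : m ≡ n [MOD p ^ k] := by
    rw [Nat.ModEq.comm, Nat.modEq_iff_dvd, Nat.cast_pow, ← PadicInt.pow_p_dvd_int_iff]
    exact_mod_cast h
  have hper := padicGammaNat_periodic hp2 hk
  have hcast : (padicGammaNat p n : ZMod (p ^ k)) = padicGammaNat p m := by
    rw [← hper.map_mod_nat n, ← hper.map_mod_nat m, hmod]
  rw [← Int.cast_sub, PadicInt.pow_p_dvd_int_iff]
  exact_mod_cast (ZMod.intCast_eq_intCast_iff_dvd_sub _ _ _).1 hcast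

end PrimePowerModulus

section PadicIntegers

variable {p : ℕ} [hp : Fact p.Prime]

theorem padicInt_norm_le_iff_pow_dvd (x : ℤ_[p]) (k : ℕ) :
    ‖x‖ ≤ (p : ℝ) ^ (-k : ℤ) ↔ (p : ℤ_[p]) ^ k ∣ x := by
  rw [PadicInt.norm_le_pow_iff_mem_span_pow, Ideal.mem_span_singleton]

theorem padicInt_not_isUnit_iff_dvd {x : ℤ_[p]} : ¬ IsUnit x ↔ (p : ℤ_[p]) ∣ x := by
  rw [PadicInt.not_isUnit_iff, PadicInt.norm_lt_one_iff_dvd]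

theorem padicInt_isUnit_natCast_iff (n : ℕ) : IsUnit (n : ℤ_[p]) ↔ ¬ p ∣ n := by
  rw [PadicInt.isUnit_iff, PadicInt.norm_natCast_eq_one_iff, hp.out.coprime_iff_not_dvd]

theorem padicInt_isUnit_two (hp2 : p ≠ 2) : IsUnit (2 : ℤ_[p]) := by
  exact_mod_cast (padicInt_isUnit_natCast_iff 2).2 (not_prime_dvd_two hp2)

theorem eventually_pow_dvd_sub (x : ℤ_[p]) (k : ℕ) : ∀ᶠ y in nhds x, (p : ℤ_[p]) ^ k ∣ y - x := by
  have hradius : (0 : ℝ) < (p : ℝ) ^ (-k : ℤ) := zpow_pos (by exact_mod_cast hp.out.pos) _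
  filter_upwards [Metric.ball_mem_nhds x hradius] with y hy
  rw [← padicInt_norm_le_iff_pow_dvd, ← dist_eq_norm]
  exact (Metric.mem_ball.1 hy).le

theorem exists_forall_pow_dvd_norm_lt {ε : ℝ} (hε : 0 < ε) :
    ∃ k ≠ 0, ∀ x : ℤ_[p], (p : ℤ_[p]) ^ k ∣ x → ‖x‖ < ε := by
  obtain ⟨k, hk⟩ := PadicInt.exists_pow_neg_lt p hε
  refine ⟨k + 1, k.succ_ne_zero, fun x hx => ?_⟩
  exact ((padicInt_norm_le_iff_pow_dvd x k).2 (dvd_trans (pow_dvd_pow _ k.le_succ) hx)).trans_lt hk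

theorem continuous_of_pow_dvd_sub {f : ℤ_[p] → ℤ_[p]}
    (hf : ∀ k ≠ 0, ∀ x y : ℤ_[p], (p : ℤ_[p]) ^ k ∣ x - y → (p : ℤ_[p]) ^ k ∣ f x - f y) :
    Continuous f := by
  refine continuous_iff_continuousAt.2 fun x => Metric.tendsto_nhds.2 fun ε hε => ?_
  obtain ⟨k, hk, hlt⟩ := exists_forall_pow_dvd_norm_lt (p := p) hε
  filter_upwards [eventually_pow_dvd_sub x k] with y hy
  rw [dist_eq_norm]
  exact hlt _ (hf k hk y x hy)

instance neBot_comap_natCast_nhds (x : ℤ_[p]) :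
    (Filter.comap (fun n : ℕ => (n : ℤ_[p])) (nhds x)).NeBot :=
  Filter.comap_neBot fun _ ht => PadicInt.denseRange_natCast.mem_nhds ht

theorem eventually_pow_dvd_natCast_sub (x : ℤ_[p]) (k : ℕ) :
    ∀ᶠ n : ℕ in Filter.comap (fun n : ℕ => (n : ℤ_[p])) (nhds x), (p : ℤ_[p]) ^ k ∣ n - x :=
  (eventually_pow_dvd_sub x k).comap _

theorem tendsto_padicGammaNat (hp2 : p ≠ 2) (x : ℤ_[p]) :
    Filter.Tendsto (fun n : ℕ => (padicGammaNat p n : ℤ_[p]))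
      (Filter.comap (fun n : ℕ => (n : ℤ_[p])) (nhds x)) (nhds (padicGamma p x)) := by
  refine tendsto_nhds_limUnder ?_
  rw [← cauchy_map_iff_exists_tendsto, Metric.cauchy_iff]
  refine ⟨inferInstance, fun ε hε => ?_⟩
  obtain ⟨k, hk, hlt⟩ := exists_forall_pow_dvd_norm_lt (p := p) hε
  refine ⟨_, Filter.image_mem_map (eventually_pow_dvd_natCast_sub x k), ?_⟩
  rintro _ ⟨m, hm, rfl⟩ _ ⟨n, hn, rfl⟩
  rw [dist_eq_norm]
  refine hlt _ (pow_dvd_padicGammaNat_sub hp2 hk ?_)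
  simpa only [sub_sub_sub_cancel_right] using dvd_sub (Set.mem_ofPred.1 hm) (Set.mem_ofPred.1 hn)

theorem pow_dvd_padicGamma_sub (hp2 : p ≠ 2) {k : ℕ} (hk : k ≠ 0) {x y : ℤ_[p]}
    (h : (p : ℤ_[p]) ^ k ∣ x - y) : (p : ℤ_[p]) ^ k ∣ padicGamma p x - padicGamma p y := by
  rw [← padicInt_norm_le_iff_pow_dvd]
  refine le_of_tendsto (((tendsto_padicGammaNat hp2 x).comp Filter.tendsto_fst).sub
    ((tendsto_padicGammaNat hp2 y).comp Filter.tendsto_snd)).norm ?_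
  filter_upwards [(eventually_pow_dvd_natCast_sub x k).prod_mk (eventually_pow_dvd_natCast_sub y k)]
    with ⟨m, n⟩ ⟨hm, hn⟩
  refine (padicInt_norm_le_iff_pow_dvd _ _).2 (pow_dvd_padicGammaNat_sub hp2 hk ?_)
  have hmn := dvd_sub (dvd_add hm h) hn
  rwa [show (m - x + (x - y) - (n - y) : ℤ_[p]) = m - n by ring] at hmn

theorem continuous_padicGamma (hp2 : p ≠ 2) : Continuous (padicGamma p) :=
  continuous_of_pow_dvd_sub fun _ hk _ _ => pow_dvd_padicGamma_sub hp2 hk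

theorem continuous_gammaStep : Continuous (gammaStep : ℤ_[p] → ℤ_[p]) := by
  refine continuous_of_pow_dvd_sub fun k hk x y h => ?_
  have hxy : ¬ IsUnit (x - y) := padicInt_not_isUnit_iff_dvd.2 (dvd_trans (dvd_pow_self _ hk) h)
  have hx := gammaStep_add hxy y
  rw [add_sub_cancel] at hx
  rw [hx, show gammaStep y * (1 + (x - y) * y⁻¹ʳ) - gammaStep y =
    (x - y) * (gammaStep y * y⁻¹ʳ) by ring]
  exact h.mul_right _

theorem padicGamma_natCast (hp2 : p ≠ 2) (n : ℕ) : padicGamma p n = padicGammaNat p n := by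
  have hpure : Filter.Tendsto (fun m : ℕ => (m : ℤ_[p])) (pure n) (nhds n) :=
    tendsto_pure_nhds _ n
  exact tendsto_nhds_unique (tendsto_pure_nhds (fun n : ℕ => (padicGammaNat p n : ℤ_[p])) n)
    ((tendsto_padicGammaNat hp2 n).mono_left hpure.le_comap) |>.symm

theorem padicGamma_zero (hp2 : p ≠ 2) : padicGamma p 0 = 1 := by
  simpa [padicGammaNat_zero] using padicGamma_natCast hp2 0

theorem padicGamma_add_one (hp2 : p ≠ 2) (x : ℤ_[p]) :
    padicGamma p (x + 1) = gammaStep x * padicGamma p x := by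
  have hcont := continuous_padicGamma hp2
  refine congrFun (PadicInt.denseRange_natCast.equalizer (hcont.comp (continuous_add_const 1))
    (continuous_gammaStep.mul hcont) (funext fun n => ?_)) x
  have h := intCast_padicGammaNat_succ (padicInt_isUnit_natCast_iff (p := p)) n
  simpa [← padicGamma_natCast hp2] using h

theorem padicGamma_one (hp2 : p ≠ 2) : padicGamma p 1 = -1 := by
  simpa [padicGamma_zero hp2, gammaStep_of_not_isUnit] using padicGamma_add_one hp2 0

theorem padicGamma_add_natCast (hp2 : p ≠ 2) (x : ℤ_[p]) (m : ℕ) :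
    padicGamma p (x + m) = (∏ i ∈ range m, gammaStep (x + i)) * padicGamma p x := by
  induction m with
  | zero => simp
  | succ m ih =>
    rw [Nat.cast_succ, ← add_assoc, padicGamma_add_one hp2, ih, prod_range_succ]
    ring

theorem padicGamma_mul_one_sub_sq (hp2 : p ≠ 2) (x : ℤ_[p]) :
    (padicGamma p x * padicGamma p (1 - x)) ^ 2 = 1 := by
  have hcont := continuous_padicGamma hp2
  refine congrFun (PadicInt.denseRange_natCast.equalizer
    ((hcont.mul (hcont.comp (continuous_sub_left 1))).pow 2) (continuous_const (y := 1))
    (funext fun n => ?_)) x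
  induction n with
  | zero => simp [padicGamma_zero hp2, padicGamma_one hp2]
  | succ n ih =>
    simp only [Pi.pow_apply, Pi.mul_apply, Function.comp_apply, Nat.cast_succ] at ih ⊢
    have hneg := padicGamma_add_one hp2 (-n : ℤ_[p])
    rw [neg_add_eq_sub] at hneg
    rw [hneg, mul_pow, mul_pow, gammaStep_neg_sq] at ih
    rw [padicGamma_add_one hp2, sub_add_cancel_right, mul_pow, mul_pow]
    linear_combination ih

theorem isUnit_padicGamma (hp2 : p ≠ 2) (x : ℤ_[p]) : IsUnit (padicGamma p x) :=
  .of_mul_eq_one (padicGamma p x * padicGamma p (1 - x) ^ 2)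
    (by linear_combination padicGamma_mul_one_sub_sq hp2 x)

end PadicIntegers

section Reflection

variable {p : ℕ} [hp : Fact p.Prime]

theorem padicGamma_natCast_mul_one_sub (hp2 : p ≠ 2) {n : ℕ} (hn : 1 ≤ n) (hnp : n ≤ p) :
    padicGamma p n * padicGamma p (1 - n) = (-1) ^ n := by
  induction n, hn using Nat.le_induction with
  | base => simp [padicGamma_zero hp2, padicGamma_one hp2]
  | succ n hn ih =>
    have hunit : IsUnit (n : ℤ_[p]) :=
      (padicInt_isUnit_natCast_iff n).2 (Nat.not_dvd_of_pos_of_lt hn hnp)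
    have hneg := padicGamma_add_one hp2 (-n : ℤ_[p])
    rw [neg_add_eq_sub, gammaStep_of_isUnit hunit.neg] at hneg
    rw [Nat.cast_succ, padicGamma_add_one hp2, gammaStep_of_isUnit hunit, sub_add_cancel_right,
      pow_succ, ← ih (by omega), hneg]
    ring

theorem padicGamma_mul_one_sub_congr (hp2 : p ≠ 2) {x y : ℤ_[p]} (h : (p : ℤ_[p]) ∣ x - y) :
    padicGamma p x * padicGamma p (1 - x) = padicGamma p y * padicGamma p (1 - y) := by
  have hy := isUnit_padicGamma hp2 y |>.mul (isUnit_padicGamma hp2 (1 - y))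
  have hsq := (padicGamma_mul_one_sub_sq hp2 x).trans (padicGamma_mul_one_sub_sq hp2 y).symm
  refine (eq_or_eq_neg_of_sq_eq_sq_of_isUnit (padicInt_isUnit_two hp2) hy hsq).resolve_right
    fun hneg => ?_
  have hlip {a b : ℤ_[p]} (hab : (p : ℤ_[p]) ∣ a - b) :
      (p : ℤ_[p]) ∣ padicGamma p a - padicGamma p b := by
    simpa using pow_dvd_padicGamma_sub hp2 one_ne_zero (by simpa using hab)
  have hdvd : (p : ℤ_[p]) ∣ -2 * (padicGamma p y * padicGamma p (1 - y)) := by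
    have hsum := ((hlip h).mul_right (padicGamma p (1 - x))).add
      ((hlip (a := 1 - x) (b := 1 - y) (by simpa using h.neg_right)).mul_left (padicGamma p y))
    convert hsum using 1
    linear_combination -hneg
  exact padicInt_not_isUnit_iff_dvd.2 hdvd ((padicInt_isUnit_two hp2).neg.mul hy)

theorem padicGamma_mul_one_sub (hp2 : p ≠ 2) {n : ℕ} (hn : 1 ≤ n) (hnp : n ≤ p) {x : ℤ_[p]}
    (h : (p : ℤ_[p]) ∣ x - n) : padicGamma p x * padicGamma p (1 - x) = (-1) ^ n :=
  (padicGamma_mul_one_sub_congr hp2 h).trans (padicGamma_natCast_mul_one_sub hp2 hn hnp)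

theorem padicGamma_add_natCast_of_isUnit (hp2 : p ≠ 2) {x : ℤ_[p]} {m : ℕ}
    (hx : ∀ i < m, IsUnit (x + i)) :
    padicGamma p (x + m) = (-1) ^ m * (ascPochhammer ℤ_[p] m).eval x * padicGamma p x := by
  induction m with
  | zero => simp
  | succ m ih =>
    rw [Nat.cast_succ, ← add_assoc, padicGamma_add_one hp2,
      ih fun i hi => hx i (hi.trans m.lt_succ_self), gammaStep_of_isUnit (hx m m.lt_succ_self),
      ascPochhammer_succ_eval]
    ring

theorem padicGamma_add_natCast_mul_of_not_isUnit (hp2 : p ≠ 2) {x : ℤ_[p]} {m r : ℕ} (hr : r < m)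
    (hx : ∀ i < m, IsUnit (x + i) ↔ i ≠ r) :
    padicGamma p (x + m) * (x + r) =
      (-1) ^ m * (ascPochhammer ℤ_[p] m).eval x * padicGamma p x := by
  induction m, hr using Nat.le_induction with
  | base =>
    rw [Nat.cast_succ, ← add_assoc, padicGamma_add_one hp2,
      gammaStep_of_not_isUnit (by simp [hx r r.lt_succ_self]), ascPochhammer_succ_eval,
      padicGamma_add_natCast_of_isUnit hp2 fun i hi => (hx i (hi.trans r.lt_succ_self)).2 hi.ne,
      pow_succ]
    ring
  | succ m hr ih =>
    rw [Nat.cast_succ, ← add_assoc, padicGamma_add_one hp2, ascPochhammer_succ_eval,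
      gammaStep_of_isUnit ((hx m m.lt_succ_self).2 (Nat.ne_of_gt hr))]
    linear_combination -(x + m) * ih fun i hi => hx i (hi.trans m.lt_succ_self)

theorem isUnit_add_natCast_iff {x : ℤ_[p]} {a b : ℕ} (ha : ¬ p ∣ a) (hx : (a : ℤ_[p]) * x = b)
    (i : ℕ) : IsUnit (x + i) ↔ ¬ p ∣ b + a * i := by
  rw [← padicInt_isUnit_natCast_iff, Nat.cast_add, Nat.cast_mul, ← hx, ← mul_add, IsUnit.mul_iff,
    and_iff_right ((padicInt_isUnit_natCast_iff a).2 ha)]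

end Reflection

section SecondDifference

variable {p : ℕ} [hp : Fact p.Prime]

/-- The power sum `∑ 1 / (x + j) ^ k` over the units among `p` consecutive `p`-adic integers
`x + j`; for `k ≠ 0` nonunits contribute nothing because `Ring.inverse` vanishes on them. -/
noncomputable def invPowerSum (x : ℤ_[p]) (k : ℕ) : ℤ_[p] := ∑ j ∈ range p, (x + j)⁻¹ʳ ^ k

theorem toZMod_ringInverse (x : ℤ_[p]) : PadicInt.toZMod x⁻¹ʳ = (PadicInt.toZMod x)⁻¹ := by
  by_cases hx : IsUnit x
  · refine eq_inv_of_mul_eq_one_left ?_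
    rw [← map_mul, inverse_mul_cancel x hx, map_one]
  · have hker : PadicInt.toZMod x = 0 := by
      rwa [← RingHom.mem_ker, PadicInt.ker_toZMod, IsLocalRing.mem_maximalIdeal]
    rw [inverse_non_unit x hx, hker, map_zero, inv_zero]

theorem prime_dvd_iff_toZMod_eq_zero (x : ℤ_[p]) : (p : ℤ_[p]) ∣ x ↔ PadicInt.toZMod x = 0 := by
  rw [← RingHom.mem_ker, PadicInt.ker_toZMod, IsLocalRing.mem_maximalIdeal, mem_nonunits_iff,
    padicInt_not_isUnit_iff_dvd]

theorem prime_dvd_invPowerSum (x : ℤ_[p]) {k : ℕ} (hk : k < p - 1) :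
    (p : ℤ_[p]) ∣ invPowerSum x k := by
  rw [prime_dvd_iff_toZMod_eq_zero, invPowerSum, map_sum]
  simp only [map_pow, toZMod_ringInverse, map_add, map_natCast]
  rw [sum_range_add_zmod_natCast p _ fun a : ZMod p => a⁻¹ ^ k]
  exact (Equiv.sum_comp (Equiv.inv (ZMod p)) fun a => a ^ k).trans <|
    FiniteField.sum_pow_lt_card_sub_one (ZMod p) k (by rwa [ZMod.card])

theorem prod_gammaStep_add {y : ℤ_[p]} (hy : (p : ℤ_[p]) ∣ y) (x : ℤ_[p]) :
    ∏ j ∈ range p, gammaStep (x + y + j) =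
      (∏ j ∈ range p, gammaStep (x + j)) * ∏ j ∈ range p, (1 + y * (x + j)⁻¹ʳ) := by
  rw [← prod_mul_distrib]
  refine prod_congr rfl fun j _ => ?_
  rw [add_right_comm, gammaStep_add (padicInt_not_isUnit_iff_dvd.2 hy)]

theorem padicGamma_add_prime_mul_sub_eq (hp2 : p ≠ 2) (w S : ℤ_[p]) {y : ℤ_[p]}
    (hy : (p : ℤ_[p]) ∣ y) :
    padicGamma p (w + y + p) * padicGamma p (w - y) -
        padicGamma p (w + y) * padicGamma p (w - y + p) * (1 + 2 * y * S) =
      padicGamma p (w + y) * padicGamma p (w - y) * (∏ j ∈ range p, gammaStep (w + j)) *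
        (∏ j ∈ range p, (1 + y * (w + j)⁻¹ʳ) -
          (∏ j ∈ range p, (1 + -y * (w + j)⁻¹ʳ)) * (1 + 2 * y * S)) := by
  rw [padicGamma_add_natCast hp2, padicGamma_add_natCast hp2, sub_eq_add_neg w,
    prod_gammaStep_add hy, prod_gammaStep_add hy.neg_right]
  ring

theorem sq_dvd_padicGamma_add_prime_mul_sub (hp2 : p ≠ 2) (w : ℤ_[p]) {y : ℤ_[p]}
    (hy : (p : ℤ_[p]) ∣ y) :
    (p : ℤ_[p]) ^ 2 ∣ padicGamma p (w + y + p) * padicGamma p (w - y) -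
      padicGamma p (w + y) * padicGamma p (w - y + p) * (1 + 2 * y * invPowerSum w 1) := by
  rw [padicGamma_add_prime_mul_sub_eq hp2 w _ hy]
  simp only [invPowerSum, pow_one]
  exact ((pow_dvd_pow_of_dvd hy 2).trans (sq_dvd_prod_one_add_mul_sub _ _ _)).mul_left _

theorem padicInt_isUnit_six (hp3 : 3 < p) : IsUnit (6 : ℤ_[p]) := by
  have hp6 : Nat.Coprime p (2 * 3) := .mul_right
    ((Nat.coprime_primes hp.out Nat.prime_two).2 (by omega))
    ((Nat.coprime_primes hp.out Nat.prime_three).2 (by omega))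
  exact_mod_cast (padicInt_isUnit_natCast_iff 6).2 (hp.out.coprime_iff_not_dvd.1 hp6)

theorem pow_four_dvd_padicGamma_add_prime_mul_sub (hp3 : 3 < p) (w : ℤ_[p]) {y : ℤ_[p]}
    (hy : (p : ℤ_[p]) ∣ y) :
    (p : ℤ_[p]) ^ 4 ∣ padicGamma p (w + y + p) * padicGamma p (w - y) -
      padicGamma p (w + y) * padicGamma p (w - y + p) * (1 + 2 * y * invPowerSum w 1) := by
  have hp5 : 5 ≤ p := hp.out.five_le_of_ne_two_of_ne_three (by omega) (by omega)
  have h₁ := prime_dvd_invPowerSum w (k := 1) (by omega)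
  rw [padicGamma_add_prime_mul_sub_eq (by omega) w _ hy]
  simp only [invPowerSum, pow_one] at h₁ ⊢
  exact (pow_four_dvd_prod_one_add_mul_sub (padicInt_isUnit_six hp3) _ _ hy h₁
    (prime_dvd_invPowerSum w (by omega))).mul_left _

theorem isClosed_setOf_pow_dvd (k : ℕ) : IsClosed {x : ℤ_[p] | (p : ℤ_[p]) ^ k ∣ x} := by
  simp only [← padicInt_norm_le_iff_pow_dvd]
  exact isClosed_le continuous_norm continuous_const

theorem pow_dvd_padicGamma_mul_sub_natCast (hp2 : p ≠ 2) {e : ℕ} {w x S : ℤ_[p]}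
    (hw : 2 * w + p = 2 * x) (hS : (p : ℤ_[p]) ^ e ∣ p ^ 2 * S ^ 2)
    (hstep : ∀ y : ℤ_[p], (p : ℤ_[p]) ∣ y → (p : ℤ_[p]) ^ e ∣
      padicGamma p (w + y + p) * padicGamma p (w - y) -
        padicGamma p (w + y) * padicGamma p (w - y + p) * (1 + 2 * y * S)) (m : ℕ) :
    (p : ℤ_[p]) ^ e ∣ padicGamma p (x + p * m) * padicGamma p (x - p * m) -
      padicGamma p x ^ 2 * (1 + p * m ^ 2 * S) := by
  induction m with
  | zero => simp [sq]
  | succ m ih =>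
    obtain ⟨y, hy⟩ : ∃ y, y = x - w + p * m := ⟨_, rfl⟩
    have h2y : 2 * y = p * (2 * m + 1) := by linear_combination 2 * hy - hw
    obtain ⟨a, ha⟩ := ih
    obtain ⟨b, hb⟩ := hstep y ((padicInt_isUnit_two hp2).dvd_mul_left.1 ⟨_, h2y⟩)
    obtain ⟨c, hc⟩ := hS
    rw [show w + y + p = x + p * (m + 1) by linear_combination hy,
      show w - y = x - p * (m + 1) by linear_combination hw - hy,
      show w + y = x + p * m by linear_combination hy,
      show x - p * (m + 1) + p = x - p * m by ring, h2y] at hb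
    refine ⟨b + a * (1 + p * (2 * m + 1) * S) +
      padicGamma p x ^ 2 * m ^ 2 * (2 * m + 1) * c, ?_⟩
    push_cast
    linear_combination hb + (1 + p * (2 * m + 1) * S) * ha +
      padicGamma p x ^ 2 * m ^ 2 * (2 * m + 1) * hc

theorem pow_dvd_padicGamma_mul_sub (hp2 : p ≠ 2) {e : ℕ} {w x S : ℤ_[p]}
    (hw : 2 * w + p = 2 * x) (hS : (p : ℤ_[p]) ^ e ∣ p ^ 2 * S ^ 2)
    (hstep : ∀ y : ℤ_[p], (p : ℤ_[p]) ∣ y → (p : ℤ_[p]) ^ e ∣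
      padicGamma p (w + y + p) * padicGamma p (w - y) -
        padicGamma p (w + y) * padicGamma p (w - y + p) * (1 + 2 * y * S)) (h : ℤ_[p]) :
    (p : ℤ_[p]) ^ e ∣ padicGamma p (x + p * h) * padicGamma p (x - p * h) -
      padicGamma p x ^ 2 * (1 + p * h ^ 2 * S) := by
  have hcont := continuous_padicGamma hp2
  exact PadicInt.denseRange_natCast.induction_on h
    ((isClosed_setOf_pow_dvd e).preimage (by fun_prop))
    (pow_dvd_padicGamma_mul_sub_natCast hp2 hw hS hstep)

theorem pow_four_dvd_padicGamma_mul_sub (hp3 : 3 < p) {w x : ℤ_[p]} (hw : 2 * w + p = 2 * x)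
    (h : ℤ_[p]) :
    (p : ℤ_[p]) ^ 4 ∣ padicGamma p (x + p * h) * padicGamma p (x - p * h) -
      padicGamma p x ^ 2 * (1 + p * h ^ 2 * invPowerSum w 1) := by
  refine pow_dvd_padicGamma_mul_sub (by omega) hw ?_
    (fun _ => pow_four_dvd_padicGamma_add_prime_mul_sub hp3 w) h
  rw [← mul_pow, show 4 = 2 * 2 by norm_num, pow_mul, sq (p : ℤ_[p])]
  exact pow_dvd_pow_of_dvd (mul_dvd_mul_left _ (prime_dvd_invPowerSum w (by omega))) 2

theorem sq_dvd_padicGamma_mul_sub (hp2 : p ≠ 2) (x h : ℤ_[p]) :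
    (p : ℤ_[p]) ^ 2 ∣ padicGamma p (x + p * h) * padicGamma p (x - p * h) - padicGamma p x ^ 2 := by
  obtain ⟨c, hc⟩ := (padicInt_isUnit_two hp2).exists_right_inv
  obtain ⟨w, hw⟩ : ∃ w : ℤ_[p], w = x - p * c := ⟨_, rfl⟩
  have hp2' := hp.out.two_le
  obtain ⟨s, hs⟩ := prime_dvd_invPowerSum w (k := 1) (by omega)
  obtain ⟨r, hr⟩ := pow_dvd_padicGamma_mul_sub hp2 (w := w) (x := x)
    (by linear_combination 2 * hw - p * hc) (dvd_mul_right _ _)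
    (fun _ => sq_dvd_padicGamma_add_prime_mul_sub hp2 w) h
  exact ⟨r + padicGamma p x ^ 2 * h ^ 2 * s, by
    linear_combination hr + padicGamma p x ^ 2 * p * h ^ 2 * hs⟩

end SecondDifference

section Rearrangement

variable {M : Type*} [AddCommMonoid M]

theorem sum_Icc_one_add (f : ℕ → M) (m n : ℕ) :
    ∑ i ∈ Icc 1 (m + n), f i = ∑ i ∈ Icc 1 m, f i + ∑ i ∈ Icc 1 n, f (m + i) := by
  induction n with
  | zero => simp
  | succ n ih =>
    rw [← add_assoc, sum_Icc_succ_top (by omega), sum_Icc_succ_top (by omega), ih, add_assoc,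
      add_assoc]

theorem sum_Icc_one_reflect (f : ℕ → M) (n : ℕ) :
    ∑ i ∈ Icc 1 n, f (n + 1 - i) = ∑ i ∈ Icc 1 n, f i := by
  refine sum_nbij' (fun i => n + 1 - i) (fun i => n + 1 - i) ?_ ?_ ?_ ?_ fun _ _ => rfl <;>
  · simp only [mem_Icc]
    omega

theorem sum_Icc_one_two_mul_fold (f : ℕ → M) (m : ℕ) :
    ∑ i ∈ Icc 1 (2 * m), f i = ∑ i ∈ Icc 1 m, (f i + f (2 * m + 1 - i)) := by
  rw [two_mul, sum_Icc_one_add, ← sum_Icc_one_reflect fun i => f (m + i), ← sum_add_distrib]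
  refine sum_congr rfl fun i hi => ?_
  rw [← Nat.add_sub_assoc ((mem_Icc.1 hi).2.trans m.le_succ), add_assoc]

theorem sum_Icc_one_two_mul_parity (f : ℕ → M) (m : ℕ) :
    ∑ i ∈ Icc 1 (2 * m), f i = ∑ i ∈ Icc 1 m, (f (2 * i) + f (2 * m + 1 - 2 * i)) := by
  have hpair : ∑ i ∈ Icc 1 (2 * m), f i = ∑ i ∈ Icc 1 m, (f (2 * i) + f (2 * i - 1)) := by
    induction m with
    | zero => simp
    | succ m ih =>
      rw [mul_add_one, sum_Icc_succ_top (by omega), sum_Icc_succ_top (by omega), ih,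
        sum_Icc_succ_top (by omega), add_assoc, add_comm (f (2 * m + 1))]
      rfl
  rw [hpair, sum_add_distrib, ← sum_Icc_one_reflect fun i => f (2 * i - 1), ← sum_add_distrib]
  exact sum_congr rfl fun i _ => congrArg (f (2 * i) + f ·) (by omega)

theorem sum_range_sub_natCast_add {R M : Type*} [CommRing R] [AddCommGroup M] (f : R → M)
    (x : R) (N n : ℕ) :
    ∑ j ∈ range N, f (x - n + j) =
      ∑ j ∈ range N, f (x + j) + ∑ i ∈ Icc 1 n, (f (x - i) - f (x - i + N)) := by
  induction n with
  | zero => simp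
  | succ n ih =>
    have hshift : ∑ j ∈ range N, f (x - n + j) + f (x - (n + 1 : ℕ)) =
        ∑ j ∈ range N, f (x - (n + 1 : ℕ) + j) + f (x - (n + 1 : ℕ) + N) := by
      rw [← sum_range_succ fun j : ℕ => f (x - (n + 1 : ℕ) + j), sum_range_succ', Nat.cast_zero,
        add_zero]
      congr! 3 with j
      push_cast
      ring
    rw [sum_Icc_succ_top (by omega), ← add_assoc, ← ih, ← add_sub_assoc, hshift,
      add_sub_cancel_right]

end Rearrangement

section Harmonic

variable {p : ℕ} [hp : Fact p.Prime]

/-- The harmonic number `∑ 1 / i ^ k` over `1 ≤ i ≤ m` of order `k` as a `p`-adic integer; for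
`k ≠ 0` multiples of `p` contribute nothing, so that it is `harmonicOrder k m` when `m < p`. -/
noncomputable def padicHarmonic (p : ℕ) [Fact p.Prime] (k m : ℕ) : ℤ_[p] :=
  ∑ i ∈ Icc 1 m, (i : ℤ_[p])⁻¹ʳ ^ k

theorem invPowerSum_zero {k : ℕ} (hk : k ≠ 0) :
    invPowerSum 0 k = padicHarmonic p k (p - 1) := by
  rw [invPowerSum, padicHarmonic, range_eq_Ico, sum_eq_sum_Ico_succ_bot hp.out.pos,
    ← Icc_pred_right_eq_Ico_of_not_isMin (by simp [hp.out.ne_zero])]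
  simp [hk]

theorem padicInt_not_isUnit_prime_mul (y : ℤ_[p]) : ¬ IsUnit ((p : ℤ_[p]) * y) :=
  padicInt_not_isUnit_iff_dvd.2 (dvd_mul_right _ y)

theorem pow_three_dvd_invPowerSum_one_add_sub (x y : ℤ_[p]) :
    (p : ℤ_[p]) ^ 3 ∣ invPowerSum (x + p * y : ℤ_[p]) 1 -
      (invPowerSum x 1 - p * y * invPowerSum x 2 + (p * y) ^ 2 * invPowerSum x 3) := by
  simp only [invPowerSum, mul_sum, ← sum_add_distrib, ← sum_sub_distrib, pow_one]
  refine dvd_sum fun j _ => ?_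
  rw [add_right_comm]
  exact (pow_dvd_pow_of_dvd (dvd_mul_right _ y) 3).trans
    (cube_dvd_inverse_add_sub (padicInt_not_isUnit_prime_mul y) _)

theorem pow_three_dvd_invPowerSum_sub_natCast_sub (y : ℤ_[p]) (n : ℕ) :
    (p : ℤ_[p]) ^ 3 ∣ invPowerSum (p * y - n : ℤ_[p]) 1 -
      (invPowerSum (p * y : ℤ_[p]) 1 + (p : ℤ_[p]) * padicHarmonic p 2 n +
        p ^ 2 * (2 * y + 1) * padicHarmonic p 3 n) := by
  have hexp (z x : ℤ_[p]) : (p : ℤ_[p]) ^ 3 ∣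
      (-x + p * z)⁻¹ʳ + x⁻¹ʳ + p * z * x⁻¹ʳ ^ 2 + (p * z) ^ 2 * x⁻¹ʳ ^ 3 := by
    convert (pow_dvd_pow_of_dvd (dvd_mul_right _ z) 3).trans
      (cube_dvd_inverse_add_sub (padicInt_not_isUnit_prime_mul z) (-x)) using 1
    rw [ringInverse_neg]
    ring
  rw [invPowerSum, sum_range_sub_natCast_add fun x : ℤ_[p] => x⁻¹ʳ ^ 1]
  simp only [invPowerSum, padicHarmonic, mul_sum, add_assoc, add_sub_add_left_eq_sub,
    ← sum_add_distrib, ← sum_sub_distrib, pow_one]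
  refine dvd_sum fun i _ => ?_
  convert (hexp y i).sub (hexp (y + 1) i) using 1
  rw [show (p : ℤ_[p]) * y - i = -i + p * y by ring,
    show -(i : ℤ_[p]) + p * y + p = -i + p * (y + 1) by ring]
  ring

theorem natCast_prime_sub {i : ℕ} (hi : i ≤ p) : ((p - i : ℕ) : ℤ_[p]) = -i + p := by
  rw [Nat.cast_sub hi, neg_add_eq_sub]

theorem sq_dvd_inverse_prime_sub_sq_sub {i : ℕ} (hi : i ≤ p) :
    (p : ℤ_[p]) ^ 2 ∣ ((p - i : ℕ) : ℤ_[p])⁻¹ʳ ^ 2 -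
      ((i : ℤ_[p])⁻¹ʳ ^ 2 + 2 * p * (i : ℤ_[p])⁻¹ʳ ^ 3) := by
  rw [natCast_prime_sub hi]
  convert sq_dvd_inverse_add_sq_sub (padicInt_not_isUnit_iff_dvd.2 dvd_rfl) (-i : ℤ_[p]) using 1
  rw [ringInverse_neg]
  ring

theorem pow_three_dvd_two_mul_padicHarmonic_one (hp3 : 3 < p) :
    (p : ℤ_[p]) ^ 3 ∣ 2 * padicHarmonic p 1 (p - 1) + p * padicHarmonic p 2 (p - 1) := by
  have hp5 : 5 ≤ p := hp.out.five_le_of_ne_two_of_ne_three (by omega) (by omega)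
  have hrefl : (p : ℤ_[p]) ^ 3 ∣ padicHarmonic p 1 (p - 1) + (padicHarmonic p 1 (p - 1) +
      p * padicHarmonic p 2 (p - 1) + p ^ 2 * padicHarmonic p 3 (p - 1)) := by
    have h := sum_Icc_one_reflect (fun i : ℕ => (i : ℤ_[p])⁻¹ʳ ^ 1) (p - 1)
    rw [Nat.sub_add_cancel hp.out.one_le] at h
    nth_rw 1 [padicHarmonic]
    rw [← h]
    simp only [padicHarmonic, mul_sum, ← sum_add_distrib, pow_one]
    refine dvd_sum fun i hi => ?_
    rw [natCast_prime_sub (by grind)]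
    convert cube_dvd_inverse_add_sub (padicInt_not_isUnit_iff_dvd.2 dvd_rfl) (-i : ℤ_[p]) using 1
    rw [ringInverse_neg]
    ring
  obtain ⟨d, hd⟩ := prime_dvd_invPowerSum (p := p) 0 (k := 3) (by omega)
  rw [invPowerSum_zero three_ne_zero] at hd
  obtain ⟨c, hc⟩ := hrefl
  exact ⟨c - d, by linear_combination hc - p ^ 2 * hd⟩

theorem sq_dvd_padicHarmonic_two_fold {m : ℕ} (hm : p = 2 * m + 1) :
    (p : ℤ_[p]) ^ 2 ∣ padicHarmonic p 2 (p - 1) -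
      (2 * padicHarmonic p 2 m + 2 * p * padicHarmonic p 3 m) := by
  simp only [padicHarmonic, show p - 1 = 2 * m by omega, sum_Icc_one_two_mul_fold, ← hm, mul_sum,
    ← sum_add_distrib, ← sum_sub_distrib]
  refine dvd_sum fun i hi => ?_
  convert sq_dvd_inverse_prime_sub_sq_sub (p := p) (i := i) (by grind) using 1
  ring

theorem two_pow_mul_inverse_two_mul_pow (hp2 : p ≠ 2) (x : ℤ_[p]) (k : ℕ) :
    2 ^ k * (2 * x)⁻¹ʳ ^ k = x⁻¹ʳ ^ k := by
  rw [← mul_pow, mul_inverse_rev, mul_left_comm, mul_inverse_cancel _ (padicInt_isUnit_two hp2),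
    mul_one]

theorem sq_dvd_padicHarmonic_two_parity {m : ℕ} (hm : p = 2 * m + 1) :
    (p : ℤ_[p]) ^ 2 ∣ 4 * padicHarmonic p 2 (p - 1) -
      (2 * padicHarmonic p 2 m + p * padicHarmonic p 3 m) := by
  simp only [padicHarmonic, show p - 1 = 2 * m by omega, sum_Icc_one_two_mul_parity, ← hm, mul_sum,
    ← sum_add_distrib, ← sum_sub_distrib]
  refine dvd_sum fun i hi => ?_
  have h := (sq_dvd_inverse_prime_sub_sq_sub (p := p) (i := 2 * i) (by grind)).mul_left 4
  convert h using 1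
  have h₂ := two_pow_mul_inverse_two_mul_pow (p := p) (by omega) i 2
  have h₃ := two_pow_mul_inverse_two_mul_pow (p := p) (by omega) i 3
  push_cast
  linear_combination 2 * h₂ + p * h₃

theorem prime_dvd_padicHarmonic_three_quarter {n : ℕ} (hn : p = 4 * n + 1) :
    (p : ℤ_[p]) ∣ 2 * padicHarmonic p 3 n - 9 * padicHarmonic p 3 (2 * n) := by
  have hsplit : padicHarmonic p 3 (2 * n) =
      padicHarmonic p 3 n + ∑ i ∈ Icc 1 n, ((n + i : ℕ) : ℤ_[p])⁻¹ʳ ^ 3 := by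
    rw [padicHarmonic, two_mul, sum_Icc_one_add, padicHarmonic]
  have hdvd : (p : ℤ_[p]) ∣ 8 * padicHarmonic p 3 (2 * n) -
      (padicHarmonic p 3 n - ∑ i ∈ Icc 1 n, ((n + i : ℕ) : ℤ_[p])⁻¹ʳ ^ 3) := by
    simp only [padicHarmonic, sum_Icc_one_two_mul_parity, mul_sum, ← sum_sub_distrib]
    refine dvd_sum fun i hi => ?_
    have h := (dvd_inverse_add_pow_sub (padicInt_not_isUnit_iff_dvd.2 dvd_rfl)
      (-(2 * (n + i : ℕ)) : ℤ_[p]) 3).mul_left 8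
    have hi₃ := two_pow_mul_inverse_two_mul_pow (p := p) (by omega) i 3
    have hni₃ := two_pow_mul_inverse_two_mul_pow (p := p) (by omega) (n + i : ℕ) 3
    rw [show 2 * n + 1 - 2 * i = p - 2 * (n + i) by omega, natCast_prime_sub (by grind)]
    convert h using 1
    rw [ringInverse_neg]
    push_cast at hi₃ hni₃ ⊢
    linear_combination hi₃ - hni₃
  convert hdvd.neg_right using 1
  linear_combination -hsplit

theorem pow_three_dvd_invPowerSum_quarter_sub {n : ℕ} (hn : p = 4 * n + 1) {q : ℤ_[p]}
    (hq : 4 * q = 1) :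
    (p : ℤ_[p]) ^ 3 ∣ invPowerSum (q - 2 * p * q : ℤ_[p]) 1 -
      (p : ℤ_[p]) * (padicHarmonic p 2 n - 2 * padicHarmonic p 2 (2 * n)) := by
  have hp3 : 3 < p := by have := hp.out.one_lt; omega
  have hpn : (p : ℤ_[p]) = 4 * n + 1 := by exact_mod_cast congrArg (Nat.cast (R := ℤ_[p])) hn
  have hw : q - 2 * p * q = (p : ℤ_[p]) * -q - n := by linear_combination -q * hpn - n * hq
  obtain ⟨a, ha⟩ := pow_three_dvd_invPowerSum_sub_natCast_sub (p := p) (-q) n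
  obtain ⟨b, hb⟩ := pow_three_dvd_invPowerSum_one_add_sub (p := p) 0 (-q)
  obtain ⟨c, hc⟩ := pow_three_dvd_two_mul_padicHarmonic_one hp3
  obtain ⟨d, hd⟩ := prime_dvd_invPowerSum (p := p) 0 (k := 3) (by omega)
  obtain ⟨e, he⟩ := sq_dvd_padicHarmonic_two_fold (p := p) (m := 2 * n) (by omega)
  obtain ⟨f, hf⟩ := sq_dvd_padicHarmonic_two_parity (p := p) (m := 2 * n) (by omega)
  obtain ⟨g, hg⟩ := prime_dvd_padicHarmonic_three_quarter hn
  rw [zero_add, invPowerSum_zero one_ne_zero, invPowerSum_zero two_ne_zero] at hb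
  rw [hw]
  have h4 : IsUnit (4 : ℤ_[p]) := .of_mul_eq_one q hq
  rw [← h4.dvd_mul_left]
  refine ⟨4 * a + 4 * b + 2 * c + 4 * q ^ 2 * d - 5 * e + f + g, ?_⟩
  linear_combination 4 * ha + 4 * hb + 2 * hc + 4 * q ^ 2 * p ^ 2 * hd - 5 * p * he + p * hf +
    p ^ 2 * hg + (p * padicHarmonic p 2 (p - 1) - 2 * p ^ 2 * padicHarmonic p 3 n) * hq

end Harmonic

section QuarterValues

variable {p : ℕ} [hp : Fact p.Prime]

theorem sq_eval_ascPochhammer_half {n : ℕ} (hn : p = 4 * n + 1) {q : ℤ_[p]} (hq : 4 * q = 1) :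
    (ascPochhammer ℤ_[p] n).eval (2 * q) ^ 2 =
      -((n.factorial : ℤ_[p]) * (padicGamma p (q + p * q) * padicGamma p (q - p * q))) ^ 2 := by
  have hp2 : p ≠ 2 := by omega
  have hpn : (p : ℤ_[p]) = 4 * n + 1 := by exact_mod_cast congrArg (Nat.cast (R := ℤ_[p])) hn
  have hpochhammer := padicGamma_add_natCast_of_isUnit hp2 (x := 2 * q) (m := n) fun i hi =>
    (isUnit_add_natCast_iff (a := 2) (b := 1) (not_prime_dvd_two hp2)
      (by push_cast; linear_combination hq) i).2 (Nat.not_dvd_of_pos_of_lt (by omega) (by omega))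
  have hfactorial := padicGamma_add_natCast_of_isUnit hp2 (x := 1) (m := n) fun i hi => by
    rw [add_comm, ← Nat.cast_succ, padicInt_isUnit_natCast_iff]
    exact Nat.not_dvd_of_pos_of_lt (by omega) (by omega)
  rw [ascPochhammer_eval_one, padicGamma_one hp2] at hfactorial
  have hhalf : padicGamma p (2 * q) ^ 2 = -1 := by
    have h := padicGamma_mul_one_sub hp2 (n := 2 * n + 1) (x := 2 * q) (by omega) (by omega)
      ⟨2 * q - 1, by push_cast; linear_combination (1 - 2 * q) * hpn - 2 * n * hq⟩
    rwa [show 1 - 2 * q = 2 * q by linear_combination -hq, ← sq,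
      Odd.neg_one_pow ⟨n, rfl⟩] at h
  have hreflect := padicGamma_mul_one_sub_sq hp2 (q - p * q)
  rw [show 1 - (q - p * q) = 1 + n by linear_combination q * hpn + n * hq, hfactorial] at hreflect
  rw [show q + p * q = 2 * q + n by linear_combination q * hpn + n * hq, hpochhammer]
  linear_combination ((n.factorial : ℤ_[p]) * (-1) ^ n * (ascPochhammer ℤ_[p] n).eval (2 * q) *
    padicGamma p (q - p * q)) ^ 2 * hhalf - (ascPochhammer ℤ_[p] n).eval (2 * q) ^ 2 * hreflect

theorem pow_four_dvd_padicGamma_quarter_sub {n : ℕ} (hn : p = 4 * n + 1) {q : ℤ_[p]}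
    (hq : 4 * q = 1) :
    (p : ℤ_[p]) ^ 4 ∣ padicGamma p q ^ 4 -
      (padicGamma p (q + p * q) * padicGamma p (q - p * q)) ^ 2 *
        (1 + p ^ 2 * q * padicHarmonic p 2 (2 * n) - 2 * p ^ 2 * q ^ 2 * padicHarmonic p 2 n) := by
  have hp3 : 3 < p := by have := hp.out.one_lt; omega
  obtain ⟨a, ha⟩ := pow_four_dvd_padicGamma_mul_sub hp3 (x := q) (w := q - 2 * p * q)
    (by linear_combination -p * hq) q
  obtain ⟨b, hb⟩ := pow_three_dvd_invPowerSum_quarter_sub hn hq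
  set K := padicHarmonic p 2 (2 * n)
  set H := padicHarmonic p 2 n
  set X := padicGamma p (q + p * q) * padicGamma p (q - p * q)
  set G := padicGamma p q
  set t := q ^ 2 * (H - 2 * K)
  have hX : X = G ^ 2 * (1 + p ^ 2 * t) + p ^ 4 * (a + G ^ 2 * q ^ 2 * b) := by
    linear_combination ha + G ^ 2 * p * q ^ 2 * hb
  have hfactor : 1 + p ^ 2 * q * K - 2 * p ^ 2 * q ^ 2 * H = 1 - 2 * p ^ 2 * t := by
    linear_combination -p ^ 2 * q * K * hq
  rw [hX, hfactor]
  exact ⟨G ^ 4 * t ^ 2 * (3 + 2 * p ^ 2 * t) - (1 - 2 * p ^ 2 * t) * (a + G ^ 2 * q ^ 2 * b) *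
    (2 * G ^ 2 * (1 + p ^ 2 * t) + p ^ 4 * (a + G ^ 2 * q ^ 2 * b)), by ring⟩

theorem isUnit_three_quarters_add_iff {r : ℕ} (hr : p = 4 * r + 3) {q : ℤ_[p]} (hq : 4 * q = 1)
    {i : ℕ} (hi : i < 2 * r + 1) : IsUnit (3 * q + i) ↔ i ≠ r := by
  rw [isUnit_add_natCast_iff (a := 4) (b := 3) (not_prime_dvd_four (by omega))
    (by push_cast; linear_combination 3 * hq),
    not_iff_not]
  constructor
  · rintro ⟨c, hc⟩
    have hc2 : c < 2 := lt_of_mul_lt_mul_left (a := p) (by omega) (Nat.zero_le _)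
    interval_cases c <;> omega
  · rintro rfl
    exact ⟨1, by omega⟩

theorem isUnit_five_quarters_add {r : ℕ} (hr : p = 4 * r + 3) {q : ℤ_[p]} (hq : 4 * q = 1) {i : ℕ}
    (hi : i < 2 * r + 1) : IsUnit (5 * q + i) := by
  rw [isUnit_add_natCast_iff (a := 4) (b := 5) (not_prime_dvd_four (by omega))
    (by push_cast; linear_combination 5 * hq)]
  rintro ⟨c, hc⟩
  have hc3 : c < 3 := lt_of_mul_lt_mul_left (a := p) (by omega) (Nat.zero_le _)
  interval_cases c <;> omega

theorem isUnit_eval_ascPochhammer_five_quarters {r : ℕ} (hr : p = 4 * r + 3) {q : ℤ_[p]}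
    (hq : 4 * q = 1) : IsUnit ((ascPochhammer ℤ_[p] (2 * r + 1)).eval (5 * q)) := by
  have h := padicGamma_add_natCast_of_isUnit (by omega) fun i hi =>
    isUnit_five_quarters_add hr hq (i := i) (hi : i < 2 * r + 1)
  exact isUnit_of_mul_isUnit_right <| isUnit_of_mul_isUnit_left <|
    h ▸ isUnit_padicGamma (by omega) _

theorem padicGamma_five_quarters (hp2 : p ≠ 2) {q : ℤ_[p]} (hq : 4 * q = 1) :
    padicGamma p (5 * q) = -q * padicGamma p q := by
  rw [show 5 * q = q + 1 by linear_combination hq, padicGamma_add_one hp2,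
    gammaStep_of_isUnit (.of_mul_eq_one 4 (by rwa [mul_comm]))]

theorem eval_ascPochhammer_three_quarters {r : ℕ} (hr : p = 4 * r + 3) {q : ℤ_[p]}
    (hq : 4 * q = 1) :
    (ascPochhammer ℤ_[p] (2 * r + 1)).eval (3 * q) =
      -(p * q ^ 2 * padicGamma p q ^ 2 *
        (padicGamma p (q + p * (2 * q)) * padicGamma p (q - p * (2 * q)))) *
      (ascPochhammer ℤ_[p] (2 * r + 1)).eval (5 * q) := by
  have hp2 : p ≠ 2 := by omega
  have hpr : (p : ℤ_[p]) = 4 * r + 3 := by exact_mod_cast congrArg (Nat.cast (R := ℤ_[p])) hr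
  have hm : ((2 * r + 1 : ℕ) : ℤ_[p]) = p * (2 * q) - 2 * q := by
    push_cast
    linear_combination (-2 * q) * hpr - (2 * r + 1) * hq
  have hthree := padicGamma_add_natCast_mul_of_not_isUnit hp2 (x := 3 * q) (m := 2 * r + 1)
    (r := r) (by omega) fun i hi => isUnit_three_quarters_add_iff hr hq hi
  have hfive := padicGamma_add_natCast_of_isUnit hp2 (x := 5 * q) (m := 2 * r + 1)
    fun i hi => isUnit_five_quarters_add hr hq hi
  rw [hm, show 3 * q + (p * (2 * q) - 2 * q) = q + p * (2 * q) by ring,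
    show 3 * q + r = p * q by linear_combination -q * hpr - r * hq,
    show 3 * q = 1 - q by linear_combination hq] at hthree
  rw [hm, padicGamma_five_quarters hp2 hq,
    show 5 * q + (p * (2 * q) - 2 * q) = 1 - (q - p * (2 * q)) by linear_combination hq] at hfive
  have hreflect := padicGamma_mul_one_sub_sq hp2 q
  have hreflect_congr : padicGamma p q * padicGamma p (1 - q) =
      padicGamma p (q - p * (2 * q)) * padicGamma p (1 - (q - p * (2 * q))) :=
    padicGamma_mul_one_sub_congr hp2 ⟨2 * q, by ring⟩
  have hsign : ((-1 : ℤ_[p]) ^ (2 * r + 1)) ^ 2 = 1 := by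
    rw [pow_right_comm, neg_one_sq, one_pow]
  rw [show 3 * q = 1 - q by linear_combination hq]
  set A := (ascPochhammer ℤ_[p] (2 * r + 1)).eval (1 - q)
  set B := (ascPochhammer ℤ_[p] (2 * r + 1)).eval (5 * q)
  set s := (-1 : ℤ_[p]) ^ (2 * r + 1)
  set G := padicGamma p q
  set K := padicGamma p (1 - q)
  set X := padicGamma p (q - p * (2 * q))
  set Y := padicGamma p (q + p * (2 * q))
  linear_combination (-A) * hreflect - A * (G * K) ^ 2 * hsign - s * G ^ 2 * K * hthree +
    Y * p * q * s * G * hreflect_congr + Y * p * q * s * G * X * hfive -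
    Y * p * q ^ 2 * G ^ 2 * X * B * hsign

end QuarterValues

section Cast

variable {p : ℕ} [hp : Fact p.Prime]

theorem padicCongr_coe_iff {e : ℕ} {x y : ℤ_[p]} :
    PadicCongr p e x y ↔ (p : ℤ_[p]) ^ e ∣ x - y :=
  exists_congr fun _ => by exact_mod_cast Subtype.coe_inj

theorem map_eval_ascPochhammer {S T : Type*} [Semiring S] [Semiring T] (f : S →+* T) (n : ℕ)
    (x : S) : f ((ascPochhammer S n).eval x) = (ascPochhammer T n).eval (f x) := by
  rw [ascPochhammer_eval₂ f, Polynomial.eval₂_at_apply]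

theorem coe_shiftedFactorial {x : ℚ} {z : ℤ_[p]} (h : (x : ℚ_[p]) = z) (n : ℕ) :
    ((shiftedFactorial x n : ℚ) : ℚ_[p]) = ((ascPochhammer ℤ_[p] n).eval z : ℤ_[p]) :=
  (map_eval_ascPochhammer (Rat.castHom ℚ_[p]) n x).trans <|
    (congrArg (Polynomial.eval · _) h).trans
      (map_eval_ascPochhammer PadicInt.Coe.ringHom n z).symm

theorem coe_ringInverse {x : ℤ_[p]} (hx : IsUnit x) :
    ((x⁻¹ʳ : ℤ_[p]) : ℚ_[p]) = (x : ℚ_[p])⁻¹ := by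
  refine eq_inv_of_mul_eq_one_left ?_
  rw [← PadicInt.coe_mul, inverse_mul_cancel x hx, PadicInt.coe_one]

theorem coe_padicHarmonic {m : ℕ} (hm : m < p) (k : ℕ) :
    (padicHarmonic p k m : ℚ_[p]) = (harmonicOrder k m : ℚ) := by
  rw [padicHarmonic, harmonicOrder, PadicInt.coe_sum, Rat.cast_sum]
  refine sum_congr rfl fun i hi => ?_
  obtain ⟨hi₁, him⟩ := mem_Icc.1 hi
  rw [PadicInt.coe_pow, coe_ringInverse <| (padicInt_isUnit_natCast_iff i).2 <|
    Nat.not_dvd_of_pos_of_lt hi₁ (him.trans_lt hm)]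
  simp

end Cast

section Congruences

variable {p : ℕ} [hp : Fact p.Prime]

theorem four_mul_padicInt_inv_four (hp2 : p ≠ 2) : 4 * PadicInt.inv (4 : ℤ_[p]) = 1 :=
  PadicInt.mul_inv <| PadicInt.isUnit_iff.1 <| by
    exact_mod_cast (padicInt_isUnit_natCast_iff 4).2 (not_prime_dvd_four hp2)

theorem coe_natCast_mul_quarter {q : ℤ_[p]} (hq : 4 * q = 1) (a : ℕ) :
    ((a * q : ℤ_[p]) : ℚ_[p]) = a / 4 := by
  have h : (4 : ℚ_[p]) * q = 1 := by exact_mod_cast congrArg ((↑) : ℤ_[p] → ℚ_[p]) hq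
  rw [PadicInt.coe_mul, PadicInt.coe_natCast, eq_div_iff (by norm_num)]
  linear_combination (a : ℚ_[p]) * h

theorem padicCongr_of_eq_four_mul_add_one {n : ℕ} (hn : p = 4 * n + 1) {q : ℤ_[p]}
    (hq : 4 * q = 1) :
    PadicCongr p 4
      ((shiftedFactorial (1 / 2) n ^ 2 / (n.factorial : ℚ) ^ 2 *
        (1 + (p : ℚ) ^ 2 / 4 * harmonicOrder 2 (2 * n)
          - (p : ℚ) ^ 2 / 8 * harmonicOrder 2 n) : ℚ) : ℚ_[p])
      (-((padicGamma p q : ℚ_[p]) ^ 4)) := by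
  have hq' : (q : ℚ_[p]) = 1 / 4 := by simpa using coe_natCast_mul_quarter hq 1
  have hpochhammer := coe_shiftedFactorial (p := p) (x := 1 / 2) (z := 2 * q)
    (by convert (coe_natCast_mul_quarter hq 2).symm using 1 <;> norm_num) n
  have hsq := congrArg ((↑) : ℤ_[p] → ℚ_[p]) (sq_eval_ascPochhammer_half hn hq)
  rw [PadicInt.coe_pow, ← hpochhammer] at hsq
  have hfactorial : (n.factorial : ℚ_[p]) ≠ 0 := by exact_mod_cast n.factorial_ne_zero
  have htwo : ((2 : ℤ_[p]) : ℚ_[p]) = 2 := rfl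
  have hdvd := pow_four_dvd_padicGamma_quarter_sub hn hq
  rw [← neg_sub_neg] at hdvd
  convert padicCongr_coe_iff.2 hdvd using 1
  · push_cast [← coe_padicHarmonic (show n < p by omega) 2,
      ← coe_padicHarmonic (show 2 * n < p by omega) 2] at hsq ⊢
    rw [hsq, hq', htwo]
    field_simp
    ring
  · push_cast
    rfl

theorem padicCongr_of_eq_four_mul_add_three {r : ℕ} (hr : p = 4 * r + 3) {q : ℤ_[p]}
    (hq : 4 * q = 1) :
    PadicCongr p 3
      ((shiftedFactorial (3 / 4) (2 * r + 1) / shiftedFactorial (5 / 4) (2 * r + 1) : ℚ) : ℚ_[p])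
      (-((p : ℚ_[p]) / 16) * (padicGamma p q : ℚ_[p]) ^ 4) := by
  have hq' : (q : ℚ_[p]) = 1 / 4 := by simpa using coe_natCast_mul_quarter hq 1
  have hthree := coe_shiftedFactorial (p := p) (x := 3 / 4) (z := 3 * q)
    (by simpa using (coe_natCast_mul_quarter hq 3).symm) (2 * r + 1)
  have hfive := coe_shiftedFactorial (p := p) (x := 5 / 4) (z := 5 * q)
    (by simpa using (coe_natCast_mul_quarter hq 5).symm) (2 * r + 1)
  have hdvd : (p : ℤ_[p]) ^ 3 ∣ -(p * q ^ 2 * padicGamma p q ^ 2 *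
      (padicGamma p (q + p * (2 * q)) * padicGamma p (q - p * (2 * q)))) -
      -(p * q ^ 2 * padicGamma p q ^ 4) := by
    obtain ⟨c, hc⟩ := sq_dvd_padicGamma_mul_sub (p := p) (by omega) q (2 * q)
    exact ⟨-(q ^ 2 * padicGamma p q ^ 2 * c), by
      linear_combination -(p * q ^ 2 * padicGamma p q ^ 2) * hc⟩
  convert padicCongr_coe_iff.2 hdvd using 1
  · rw [Rat.cast_div, hthree, hfive, eval_ascPochhammer_three_quarters hr hq, PadicInt.coe_mul,
      mul_div_cancel_right₀ _
        (PadicInt.coe_ne_zero.2 (isUnit_eval_ascPochhammer_five_quarters hr hq).ne_zero)]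
  · push_cast
    rw [hq']
    ring

end Congruences

theorem proposition1p7_general (p : ℕ) [Fact p.Prime] :
    (p % 4 = 1 →
      PadicCongr p 4
        ((shiftedFactorial (1 / 2) ((p - 1) / 4) ^ 2 / (((p - 1) / 4).factorial : ℚ) ^ 2 *
          (1 + (p : ℚ) ^ 2 / 4 * harmonicOrder 2 ((p - 1) / 2)
            - (p : ℚ) ^ 2 / 8 * harmonicOrder 2 ((p - 1) / 4)) : ℚ) : ℚ_[p])
        (-((padicGamma p (PadicInt.inv 4) : ℚ_[p]) ^ 4))) ∧
    (p % 4 = 3 →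
      PadicCongr p 3
        ((shiftedFactorial (3 / 4) ((p - 1) / 2) / shiftedFactorial (5 / 4) ((p - 1) / 2) : ℚ) :
          ℚ_[p])
        (-((p : ℚ_[p]) / 16) * (padicGamma p (PadicInt.inv 4) : ℚ_[p]) ^ 4)) := by
  refine ⟨fun hp4 => ?_, fun hp4 => ?_⟩
  · rw [show (p - 1) / 2 = 2 * ((p - 1) / 4) by omega]
    exact padicCongr_of_eq_four_mul_add_one (by omega) (four_mul_padicInt_inv_four (by omega))
  · rw [show (p - 1) / 2 = 2 * (p / 4) + 1 by omega]
    exact padicCongr_of_eq_four_mul_add_three (by omega) (four_mul_padicInt_inv_four (by omega))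

theorem proposition1p7 (p : ℕ) [Fact p.Prime] (hp : 5 < p) :
    (p % 4 = 1 →
      PadicCongr p 4
        ((shiftedFactorial (1 / 2) ((p - 1) / 4) ^ 2 / (((p - 1) / 4).factorial : ℚ) ^ 2 *
          (1 + (p : ℚ) ^ 2 / 4 * harmonicOrder 2 ((p - 1) / 2)
            - (p : ℚ) ^ 2 / 8 * harmonicOrder 2 ((p - 1) / 4)) : ℚ) : ℚ_[p])
        (-((padicGamma p (PadicInt.inv 4) : ℚ_[p]) ^ 4))) ∧
    (p % 4 = 3 →
      PadicCongr p 3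
        ((shiftedFactorial (3 / 4) ((p - 1) / 2) / shiftedFactorial (5 / 4) ((p - 1) / 2) : ℚ) :
          ℚ_[p])
        (-((p : ℚ_[p]) / 16) * (padicGamma p (PadicInt.inv 4) : ℚ_[p]) ^ 4)) :=
  proposition1p7_general p
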